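/- **Setting.** Over the binary asymmetric channel a transmitted $1$ may be received as $0$, while a transmitted $0$ is always received correctly. For $x\in\{0,1\}^n$ the cloud $B_t(x)$ is the set of words that can be received when $x$ is sent and at most $t$ such errors occur. A code of length $n$ correcting $t$ asymmetric errors is a set $\mathcal C\subseteq\{0,1\}^n$ whose clouds $B_t(x)$, $x\in\mathcal C$, are pairwise disjoint; its free points are the words of $\{0,1\}^n$ lying in none of these clouds. Let $M_Z(n,t)$ be the maximum cardinality of such a code. Let $L(n,d,w)$ and $U(n,d,w)$ be any lower and upper bounds on the maximum cardinality of a binary constant-weight code of length $n$, Hamming distance at least $d$ and weight $w$. **Theorem.** Let $n\ge 2t\ge 2$ and $1\le M\le M_Z(n,t)$. Define $$\overline F(n,M,t)=\max\Bigl(2^n-\sum_{i=0}^n z_i\sum_{j=0}^t\binom{i}{i-j}\Bigr),$$ where $\binom{i}{i-j}=0$ for $j>i$ and the maximum is over all $(z_0,\dots,z_n)$ (with $z_i:=0$ for $i<0$ and for $i>n$) that satisfy the following conditions, in which $$P_{w,s}=\sum_{i=1}^s\binom{n-w+i}{i}z_{w-i}+\sum_{j=0}^{t-s}\binom{w+j}{j}z_{w+j}.$$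 1. The $z_i$ are nonnegative integers. 2. $z_0=1$ and $z_1=\dots=z_t=0$. 3. $P_{w,s}\le\binom nw$ for $0\le s\le t<w<n-t$. 4. $\sum_{j=s}^r z_j\,L(r-s,2t+2,r-j)\le U(n+r-s,2t+2,r)$ for $0\le s\le r$. 5. $\sum_{j=s}^r z_{n-j}\,L(r-s,2t+2,r-j)\le U(n+r-s,2t+2,r)$ for $0\le s\le r$. 6. For $1\le s\le t<w<n-t$, $$P_{w,s}+\Bigl(\tbinom{w+t-s+1}{w}-\tbinom{t+1}{t-s+1}\Bigl\lfloor\tfrac{w+t-s+1}{t+1}\Bigr\rfloor\Bigr)z_{w+t-s+1}\le\tbinom nw,$$ and for $0\le s<t<w<n-t$, $$P_{w,s}+\Bigl(\tbinom{n-w+s+1}{s+1}-\tbinom{t+1}{t-s}\Bigl\lfloor\tfrac{n-w+s+1}{t+1}\Bigr\rfloor\Bigr)z_{w-s-1}\le\tbinom nw.$$ 7. $\sum_{i=0}^n z_i=M$. This maximum exists, and the number of free points of every code of length $n$ and cardinality $M$ correcting $t$ asymmetric errors is at most $\overline F(n,M,t)$. -/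

import Mathlib

namespace AsymCode

open Finset

/-- Binary words of length `n`; `true` is the symbol `1`. -/
abbrev Word (n : ℕ) : Type := Fin n → Bool

/-- The number of symbols `1` of a word. -/
def weight {n : ℕ} (x : Word n) : ℕ := #{i | x i = true}

/-- `y` can be received when `x` is sent over the binary asymmetric channel with at most `t`
errors: the only possible error turns a `1` into a `0`. -/
def Reaches {n : ℕ} (t : ℕ) (x y : Word n) : Prop :=
  (∀ i, x i ≠ y i → x i = true ∧ y i = false) ∧ hammingDist x y ≤ t

open Classical in
/-- The cloud of the codeword `x`: all words which can be received with at most `t` errors. -/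
noncomputable def cloud {n : ℕ} (t : ℕ) (x : Word n) : Finset (Word n) := {y | Reaches t x y}

/-- `C` is a (nonadaptive) code correcting `t` asymmetric errors: its clouds are disjoint. -/
def Corrects {n : ℕ} (t : ℕ) (C : Finset (Word n)) : Prop :=
  ∀ x ∈ C, ∀ y ∈ C, x ≠ y → Disjoint (cloud t x) (cloud t y)

/-- The points which belong to no cloud of `C`. -/
noncomputable def freePoints {n : ℕ} (t : ℕ) (C : Finset (Word n)) : Finset (Word n) :=
  {p | ∀ x ∈ C, p ∉ cloud t x}

open Classical in
/-- `M_Z(n, t)`: the maximum cardinality of a code of length `n` correcting `t` asymmetric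
errors. -/
noncomputable def maxCard (n t : ℕ) : ℕ :=
  Finset.sup (univ.filter fun C : Finset (Word n) => Corrects t C) Finset.card

open Classical in
/-- The maximum cardinality of a binary constant-weight code of length `n`, Hamming distance (at
least) `d` and weight `w`. -/
noncomputable def constWeightMax (n d w : ℕ) : ℕ :=
  Finset.sup
    (univ.filter fun C : Finset (Word n) =>
      (∀ x ∈ C, weight x = w) ∧ ∀ x ∈ C, ∀ y ∈ C, x ≠ y → d ≤ hammingDist x y)
    Finset.card

/-- `∑_{i=1}^{s} C(n-w+i, i) z_{w-i} + ∑_{j=0}^{t-s} C(w+j, j) z_{w+j}`, used only for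
`s ≤ t < w < n - t`, so that no subtraction is truncated. -/
def packing (n t : ℕ) (z : ℕ → ℕ) (w s : ℕ) : ℕ :=
  ∑ i ∈ Icc 1 s, (n - w + i).choose i * z (w - i) +
    ∑ j ∈ range (t - s + 1), (w + j).choose j * z (w + j)

/-- The constraints on the distribution `z_0, …, z_n`, which is extended by `z_i = 0` to `i > n`
(`supp`). The bounds `L`, `U` on constant-weight codes are functions of length, distance and
weight. -/
structure Feasible (L U : ℕ → ℕ → ℕ → ℝ) (n M t : ℕ) (z : ℕ → ℕ) : Prop where
  supp : ∀ i, n < i → z i = 0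
  zero : z 0 = 1
  small : ∀ i, 1 ≤ i → i ≤ t → z i = 0
  pack : ∀ s w, s ≤ t → t < w → w < n - t → packing n t z w s ≤ n.choose w
  low : ∀ s r, s ≤ r →
    ∑ j ∈ Icc s r, (z j : ℝ) * L (r - s) (2 * t + 2) (r - j) ≤ U (n + r - s) (2 * t + 2) r
  /- Terms with `j > n`, for which `z_{n-j} = 0`, are left out. -/
  high : ∀ s r, s ≤ r →
    ∑ j ∈ Icc s r with j ≤ n, (z (n - j) : ℝ) * L (r - s) (2 * t + 2) (r - j)
      ≤ U (n + r - s) (2 * t + 2) r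
  packUp : ∀ s w, 1 ≤ s → s ≤ t → t < w → w < n - t →
    (packing n t z w s : ℤ) +
      (((w + t - s + 1).choose w : ℤ) -
        ((t + 1).choose (t - s + 1) : ℤ) * (((w + t - s + 1) / (t + 1) : ℕ) : ℤ)) *
        (z (w + t - s + 1) : ℤ) ≤ (n.choose w : ℤ)
  packDown : ∀ s w, s < t → t < w → w < n - t →
    (packing n t z w s : ℤ) +
      (((n - w + s + 1).choose (s + 1) : ℤ) -
        ((t + 1).choose (t - s) : ℤ) * (((n - w + s + 1) / (t + 1) : ℕ) : ℤ)) *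
        (z (w - s - 1) : ℤ) ≤ (n.choose w : ℤ)
  total : ∑ i ∈ range (n + 1), z i = M

/-- `2^n - ∑_{i=0}^n z_i ∑_{j=0}^t C(i, i-j)`, where `C(i, i-j)` is `0` for `j > i` and otherwise
is written as `C(i, j)`. -/
def objective (n t : ℕ) (z : ℕ → ℕ) : ℤ :=
  2 ^ n - ∑ i ∈ range (n + 1), (z i : ℤ) * ∑ j ∈ range (t + 1), (i.choose j : ℤ)

/-- The values of the objective at the feasible points. -/
def values (L U : ℕ → ℕ → ℕ → ℝ) (n M t : ℕ) : Set ℤ :=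
  {v | ∃ z, Feasible L U n M t z ∧ v = objective n t z}

/-- The maximum of the objective over the feasible points. -/
noncomputable def Fbar (L U : ℕ → ℕ → ℕ → ℝ) (n M t : ℕ) : ℤ := sSup (values L U n M t)

end AsymCode

/-! Identify words with their supports. Clouds are disjoint exactly when any two codewords x, y have
#(x \ y) > t or #(y \ x) > t; this yields `AsymSep`. The weight distribution of a code containing 0
satisfies every constraint (`Corrects.feasible`), and its number of free points equals the
objective.

The packing constraints count w-sets comparable with codewords. Codewords sharing such a set are
nested with weights more than t apart, so t+1 consecutive weights give disjoint families
(`AsymSep.packing_le`). Adding the next weight above costs an overlap controlled by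
`AsymSep.card_below_le` (`AsymSep.packing_up_le`); complementation gives the next weight below. The
constant-weight bounds come from appending tails that equalize weights
(`AsymSep.sum_le_constWeightMax`).

A code without 0 can be changed into one with 0 and at least as many free points
(`Corrects.exists_zero_mem`), so the maximum bounds every code. -/

namespace AsymCode

open Finset

/-! ### Separated set families and the packing inequalities -/

section Families

variable {α : Type*}

/-- The number of members of `F` of cardinality `k`. -/
def weightCount (F : Finset (Finset α)) (k : ℕ) : ℕ := #{x ∈ F | #x = k}

theorem sum_mul_weightCount {R : Type*} [CommSemiring R] (F : Finset (Finset α)) (K : Finset ℕ)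
    (c : ℕ → R) :
    ∑ k ∈ K, c k * (weightCount F k : R) = ∑ x ∈ F with #x ∈ K, c #x := by
  rw [← sum_fiberwise_of_maps_to (s := {x ∈ F | #x ∈ K}) (t := K) (g := card)
    (fun x hx => (mem_filter.1 hx).2)]
  refine sum_congr rfl fun k hk => ?_
  have h : ({x ∈ F | #x ∈ K} : Finset _).filter (fun x => #x = k) = {x ∈ F | #x = k} := by
    ext x
    simp only [mem_filter]
    constructor
    · rintro ⟨⟨h1, -⟩, h2⟩
      exact ⟨h1, h2⟩
    · rintro ⟨h1, rfl⟩
      exact ⟨⟨h1, hk⟩, rfl⟩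
  rw [h, sum_congr rfl (g := fun _ => c k) (fun x hx => by rw [(mem_filter.1 hx).2]),
    sum_const, weightCount, nsmul_eq_mul, mul_comm]

theorem weightCount_eq_zero [Fintype α] (F : Finset (Finset α)) {k : ℕ} (hk : Fintype.card α < k) :
    weightCount F k = 0 := by
  refine card_eq_zero.2 (filter_eq_empty_iff.2 fun x _ => ?_)
  have := card_le_univ x
  omega

/-- The members of `F` of cardinality between `w - s` and `w + t - s`. -/
def window (t w s : ℕ) (F : Finset (Finset α)) : Finset (Finset α) :=
  {x ∈ F | w ≤ #x + s ∧ #x + s ≤ w + t}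

theorem mem_window {t w s : ℕ} {F : Finset (Finset α)} {x : Finset α} :
    x ∈ window t w s F ↔ x ∈ F ∧ w ≤ #x + s ∧ #x + s ≤ w + t := by
  simp [window]

variable [DecidableEq α]

/-- Any two members of `F` are at asymmetric distance greater than `t`. -/
def AsymSep (t : ℕ) (F : Finset (Finset α)) : Prop :=
  ∀ x ∈ F, ∀ y ∈ F, x ≠ y → t < #(x \ y) ∨ t < #(y \ x)

theorem card_between {x v : Finset α} (w : ℕ) (hxv : x ⊆ v) (hw : #x ≤ w) :
    #{u ∈ powersetCard w v | x ⊆ u} = (#v - #x).choose (w - #x) := by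
  rw [← card_sdiff_of_subset hxv, ← card_powersetCard]
  refine card_nbij' (· \ x) (x ∪ ·) ?_ ?_ ?_ ?_
  · intro u hu
    simp only [coe_filter, mem_powersetCard, Set.mem_ofPred_eq] at hu
    simp only [mem_coe, mem_powersetCard]
    exact ⟨sdiff_subset_sdiff hu.1.1 le_rfl, by rw [card_sdiff_of_subset hu.2, hu.1.2]⟩
  · intro u hu
    simp only [mem_coe, mem_powersetCard] at hu
    simp only [coe_filter, mem_powersetCard, Set.mem_ofPred_eq]
    have hd : Disjoint x u := disjoint_of_subset_right hu.1 disjoint_sdiff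
    refine ⟨⟨union_subset hxv (hu.1.trans sdiff_subset), ?_⟩, subset_union_left⟩
    rw [card_union_of_disjoint hd, hu.2]
    omega
  · intro u hu
    simp only [coe_filter, mem_powersetCard, Set.mem_ofPred_eq] at hu
    exact union_sdiff_of_subset hu.2
  · intro u hu
    simp only [mem_coe, mem_powersetCard] at hu
    have hd : Disjoint x u := disjoint_of_subset_right hu.1 disjoint_sdiff
    exact union_sdiff_cancel_left hd

theorem card_powerset_sdiff_eq (v : Finset α) (j : ℕ) :
    #{u ∈ v.powerset | #(v \ u) = j} = (#v).choose j := by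
  rw [← card_powersetCard]
  refine card_nbij' (v \ ·) (v \ ·) ?_ ?_ ?_ ?_
  · intro u hu
    simp only [coe_filter, mem_powerset, Set.mem_ofPred_eq] at hu
    simp only [mem_coe, mem_powersetCard]
    exact ⟨sdiff_subset, hu.2⟩
  · intro u hu
    simp only [mem_coe, mem_powersetCard] at hu
    simp only [coe_filter, mem_powerset, Set.mem_ofPred_eq]
    exact ⟨sdiff_subset, by rw [Finset.sdiff_sdiff_eq_self hu.1, hu.2]⟩
  · intro u hu
    simp only [coe_filter, mem_powerset, Set.mem_ofPred_eq] at hu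
    exact Finset.sdiff_sdiff_eq_self hu.1
  · intro u hu
    simp only [mem_coe, mem_powersetCard] at hu
    exact Finset.sdiff_sdiff_eq_self hu.1

theorem card_powerset_sdiff_le (v : Finset α) (t : ℕ) :
    #{u ∈ v.powerset | #(v \ u) ≤ t} = ∑ j ∈ range (t + 1), (#v).choose j := by
  rw [card_eq_sum_card_fiberwise (f := fun u => #(v \ u)) (t := range (t + 1))]
  · refine sum_congr rfl fun j hj => ?_
    rw [← card_powerset_sdiff_eq, filter_filter]
    congr 1
    refine filter_congr fun u _ => ?_
    have := mem_range.1 hj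
    constructor
    · exact fun h => h.2
    · exact fun h => ⟨by omega, h⟩
  · intro u hu
    simp only [coe_filter, Set.mem_ofPred_eq] at hu
    simp only [coe_range, Set.mem_Iio]
    omega

theorem card_sdiff_le_of_le {a b u : Finset α} (h1 : a ⊆ u) {k : ℕ} (h2 : b ⊆ u)
    (h : #u ≤ #b + k) : #(a \ b) ≤ k := by
  have h3 := card_le_card (sdiff_subset_sdiff h1 (le_refl b))
  rw [card_sdiff_of_subset h2] at h3
  omega

theorem card_sdiff_le_of_ge {a b u : Finset α} (h1 : u ⊆ a) (h2 : u ⊆ b) {k : ℕ}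
    (h : #a ≤ #u + k) : #(a \ b) ≤ k := by
  have h3 := card_le_card (sdiff_subset_sdiff (le_refl a) h2)
  rw [card_sdiff_of_subset h1] at h3
  omega

/-- The members of cardinality `#v - (t + 1)` below a set `v` have pairwise disjoint complements
in `v`. -/
theorem AsymSep.card_below_le {t : ℕ} {F : Finset (Finset α)} (hF : AsymSep t F)
    (v : Finset α) :
    #{x ∈ F | x ⊆ v ∧ #x + (t + 1) = #v} ≤ #v / (t + 1) := by
  rw [Nat.le_div_iff_mul_le (Nat.succ_pos t)]
  set X : Finset (Finset α) := {x ∈ F | x ⊆ v ∧ #x + (t + 1) = #v} with hX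
  have hd : (X : Set (Finset α)).PairwiseDisjoint (v \ ·) := by
    have key : ∀ x ∈ X, ∀ y ∈ X, t < #(x \ y) → Disjoint (v \ x) (v \ y) := by
      intro x hx y hy h
      rw [hX, mem_filter] at hx hy
      have h1 : x \ y = v \ y := by
        refine eq_of_subset_of_card_le (sdiff_subset_sdiff hx.2.1 le_rfl) ?_
        rw [card_sdiff_of_subset hy.2.1]
        omega
      rw [← h1]
      exact disjoint_of_subset_right sdiff_subset sdiff_disjoint
    intro x hx y hy hxy
    rcases hF x (mem_filter.1 hx).1 y (mem_filter.1 hy).1 hxy with h | h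
    · exact key x hx y hy h
    · exact (key y hy x hx h).symm
  have h1 : #(X.biUnion (v \ ·)) = #X * (t + 1) := by
    rw [card_biUnion hd, sum_const_nat]
    intro x hx
    rw [hX, mem_filter] at hx
    rw [card_sdiff_of_subset hx.2.1]
    omega
  rw [← h1]
  exact card_le_card (biUnion_subset.2 fun x _ => sdiff_subset)

variable [Fintype α]

/-- The sets of cardinality `w` comparable with `x`. -/
def comparable (w : ℕ) (x : Finset α) : Finset (Finset α) :=
  {u ∈ powersetCard w univ | x ⊆ u ∨ u ⊆ x}

theorem mem_comparable {w : ℕ} {x u : Finset α} :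
    u ∈ comparable w x ↔ #u = w ∧ (x ⊆ u ∨ u ⊆ x) := by
  simp [comparable, mem_powersetCard]

theorem comparable_of_card_ge {w : ℕ} {x : Finset α} (h : w ≤ #x) :
    comparable w x = powersetCard w x := by
  ext u
  rw [mem_comparable, mem_powersetCard]
  constructor
  · rintro ⟨h1, h2 | h2⟩
    · have := eq_of_subset_of_card_le h2 (by omega)
      exact ⟨this ▸ le_rfl, h1⟩
    · exact ⟨h2, h1⟩
  · rintro ⟨h1, h2⟩
    exact ⟨h2, Or.inr h1⟩

theorem card_comparable_of_ge {w : ℕ} {x : Finset α} (h : w ≤ #x) :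
    #(comparable w x) = (#x).choose w := by
  rw [comparable_of_card_ge h, card_powersetCard]

theorem card_comparable_of_le {w : ℕ} {x : Finset α} (h : #x ≤ w) :
    #(comparable w x) = (Fintype.card α - #x).choose (w - #x) := by
  rw [← card_univ, ← card_between w (subset_univ x) h]
  congr 1
  refine filter_congr fun u hu => ?_
  rw [mem_powersetCard] at hu
  refine ⟨?_, Or.inl⟩
  rintro (h2 | h2)
  · exact h2
  · exact (eq_of_subset_of_card_le h2 (by omega)) ▸ le_rfl

/-- Each binomial coefficient in `packing` counts the w-sets above or below a member of the
corresponding weight. -/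
theorem packing_weightCount (F : Finset (Finset α)) {t w s : ℕ} (hst : s ≤ t) (hsw : s ≤ w)
    (hw : w ≤ Fintype.card α) :
    packing (Fintype.card α) t (weightCount F) w s =
      ∑ x ∈ window t w s F, #(comparable w x) := by
  have h1 : ∑ i ∈ Icc 1 s, (Fintype.card α - w + i).choose i * weightCount F (w - i) =
      ∑ x ∈ F with #x ∈ Ico (w - s) w, #(comparable w x) := by
    rw [sum_congr rfl (g := fun x => (Fintype.card α - #x).choose (w - #x))]
    · rw [← Nat.cast_id (∑ x ∈ F with _, _), Nat.cast_id,
        ← sum_mul_weightCount F (Ico (w - s) w)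
          (fun k => (Fintype.card α - k).choose (w - k))]
      refine sum_nbij' (w - ·) (w - ·) ?_ ?_ ?_ ?_ ?_
      · intro i hi
        rw [mem_Icc] at hi
        rw [mem_Ico]
        omega
      · intro i hi
        rw [mem_Ico] at hi
        rw [mem_Icc]
        omega
      · intro i hi
        rw [mem_Icc] at hi
        omega
      · intro i hi
        rw [mem_Ico] at hi
        omega
      · intro i hi
        rw [mem_Icc] at hi
        simp only [Nat.cast_id]
        congr 2 <;> omega
    · intro x hx
      rw [mem_filter, mem_Ico] at hx
      exact card_comparable_of_le hx.2.2.le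
  have h2 : ∑ j ∈ range (t - s + 1), (w + j).choose j * weightCount F (w + j) =
      ∑ x ∈ F with #x ∈ Ico w (w + (t - s + 1)), #(comparable w x) := by
    rw [sum_congr rfl (g := fun x => (#x).choose (#x - w))]
    · have := sum_mul_weightCount F (Ico w (w + (t - s + 1))) (fun k => k.choose (k - w))
      simp only [Nat.cast_id] at this
      rw [← this, sum_Ico_eq_sum_range, Nat.add_sub_cancel_left]
      refine sum_congr rfl fun j _ => ?_
      rw [Nat.add_sub_cancel_left]
    · intro x hx
      rw [mem_filter, mem_Ico] at hx
      rw [card_comparable_of_ge hx.2.1, Nat.choose_symm hx.2.1]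
  rw [packing, h1, h2, ← sum_union]
  · refine sum_congr ?_ fun _ _ => rfl
    ext x
    simp only [mem_union, mem_filter, mem_Ico, mem_window, ← and_or_left]
    refine and_congr_right fun _ => ?_
    omega
  · rw [disjoint_left]
    intro x hx hx'
    rw [mem_filter, mem_Ico] at hx hx'
    omega

/-- Two distinct members of an asymmetrically separated family which are comparable with a common
set of cardinality `w` lie on different sides of it and have cardinalities more than `t` apart. -/
theorem AsymSep.of_mem_comparable {t w : ℕ} {F : Finset (Finset α)} (hF : AsymSep t F)
    {x y u : Finset α} (hx : x ∈ F) (hy : y ∈ F) (hxy : x ≠ y) (hux : u ∈ comparable w x)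
    (huy : u ∈ comparable w y) (hxl : w ≤ #x + t) (hxu : #x ≤ w + t) (hyl : w ≤ #y + t)
    (hyu : #y ≤ w + t) :
    (x ⊆ u ∧ u ⊆ y ∧ #x + t < #y) ∨ (y ⊆ u ∧ u ⊆ x ∧ #y + t < #x) := by
  rw [mem_comparable] at hux huy
  obtain ⟨hu, hux⟩ := hux
  obtain ⟨-, huy⟩ := huy
  have hs := hF x hx y hy hxy
  rcases hux with hux | hux <;> rcases huy with huy | huy
  -- On the same side of u both differences have at most t elements, against separation; on opposite
  -- sides one difference is empty, so the other is the weight gap.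
  · have h1 := card_sdiff_le_of_le hux huy (k := t) (by omega)
    have h2 := card_sdiff_le_of_le huy hux (k := t) (by omega)
    omega
  · left
    refine ⟨hux, huy, ?_⟩
    have h := hux.trans huy
    rw [sdiff_eq_empty_iff_subset.2 h, card_sdiff_of_subset h, card_empty] at hs
    omega
  · right
    refine ⟨huy, hux, ?_⟩
    have h := huy.trans hux
    rw [sdiff_eq_empty_iff_subset.2 h, card_sdiff_of_subset h, card_empty] at hs
    omega
  · have h1 := card_sdiff_le_of_ge hux huy (k := t) (by omega)
    have h2 := card_sdiff_le_of_ge huy hux (k := t) (by omega)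
    omega

/-- The window spans only t + 1 consecutive weights, so no two of its members have weights more than
t apart. -/
theorem AsymSep.pairwiseDisjoint_window {t w s : ℕ} {F : Finset (Finset α)} (hF : AsymSep t F)
    (hst : s ≤ t) :
    (window t w s F : Set (Finset α)).PairwiseDisjoint (comparable w) := by
  intro x hx y hy hxy
  rw [mem_coe, mem_window] at hx hy
  rw [Function.onFun, disjoint_left]
  intro u hux huy
  have := hF.of_mem_comparable hx.1 hy.1 hxy hux huy (by omega) (by omega) (by omega) (by omega)
  omega

theorem AsymSep.packing_le {t w s : ℕ} {F : Finset (Finset α)} (hF : AsymSep t F)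
    (hst : s ≤ t) (hsw : s ≤ w) (hw : w ≤ Fintype.card α) :
    packing (Fintype.card α) t (weightCount F) w s ≤ (Fintype.card α).choose w := by
  rw [packing_weightCount F hst hsw hw, ← card_biUnion (hF.pairwiseDisjoint_window hst),
    ← card_univ, ← card_powersetCard]
  exact card_le_card (biUnion_subset.2 fun x _ => filter_subset _ _)

/-- A member v just above the window contributes the w-sets below it that the window has not used.
Only window members x ⊆ v of the lowest weight w - s, which is #v - (t + 1), can have used them.
There are at most #v / (t + 1) such x, and C(t+1, s) = C(t+1, t-s+1) sets of size w lie between x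
and v. -/
theorem AsymSep.packing_up_le {t w s : ℕ} {F : Finset (Finset α)} (hF : AsymSep t F)
    (hs : 1 ≤ s) (hst : s ≤ t) (hsw : s ≤ w) (hw : w ≤ Fintype.card α) :
    (packing (Fintype.card α) t (weightCount F) w s : ℤ) +
      (((w + t - s + 1).choose w : ℤ) -
        ((t + 1).choose (t - s + 1) : ℤ) * (((w + t - s + 1) / (t + 1) : ℕ) : ℤ)) *
        (weightCount F (w + t - s + 1) : ℤ) ≤ ((Fintype.card α).choose w : ℤ) := by
  set B : Finset (Finset α) := {x ∈ F | #x = w + t - s + 1} with hB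
  set U := (window t w s F).biUnion (comparable w) with hU
  have hBd : (B : Set (Finset α)).PairwiseDisjoint (fun v => comparable w v \ U) := by
    intro x hx y hy hxy
    rw [mem_coe, hB, mem_filter] at hx hy
    rw [Function.onFun, disjoint_left]
    intro u hux huy
    rw [mem_sdiff] at hux huy
    have := hF.of_mem_comparable hx.1 hy.1 hxy hux.1 huy.1 (by omega) (by omega) (by omega)
      (by omega)
    omega
  have hov : ∀ v ∈ B, #(comparable w v ∩ U) ≤
      (w + t - s + 1) / (t + 1) * (t + 1).choose (t - s + 1) := by
    intro v hv
    rw [hB, mem_filter] at hv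
    have hsub : comparable w v ∩ U ⊆
        ({x ∈ F | x ⊆ v ∧ #x + (t + 1) = #v} : Finset _).biUnion
          (fun x => {u ∈ powersetCard w v | x ⊆ u}) := by
      intro u hu
      rw [mem_inter, hU, mem_biUnion] at hu
      obtain ⟨huv, x, hx, hux⟩ := hu
      rw [mem_window] at hx
      have hne : x ≠ v := by
        rintro rfl
        omega
      -- Here s ≥ 1 keeps the weight of v within t of w.
      have h := hF.of_mem_comparable hx.1 hv.1 hne hux huv (by omega) (by omega) (by omega)
        (by omega)
      rcases h with ⟨h1, h2, h3⟩ | ⟨h1, h2, h3⟩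
      · rw [mem_biUnion]
        refine ⟨x, mem_filter.2 ⟨hx.1, h1.trans h2, by omega⟩, mem_filter.2 ⟨?_, h1⟩⟩
        exact mem_powersetCard.2 ⟨h2, (mem_comparable.1 huv).1⟩
      · omega
    refine (card_le_card hsub).trans (card_biUnion_le.trans ?_)
    refine (sum_le_card_nsmul _ _ ((t + 1).choose (t - s + 1)) ?_).trans ?_
    · intro x hx
      rw [mem_filter] at hx
      rw [card_between w hx.2.1 (by omega), ← hx.2.2, Nat.add_sub_cancel_left,
        ← Nat.choose_symm (by omega)]
      refine le_of_eq ?_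
      congr 1
      omega
    · rw [smul_eq_mul]
      refine Nat.mul_le_mul_right _ ?_
      rw [← hv.2]
      exact hF.card_below_le v
  have hlow : ∀ v ∈ B, ((w + t - s + 1).choose w : ℤ) -
      ((t + 1).choose (t - s + 1) : ℤ) * (((w + t - s + 1) / (t + 1) : ℕ) : ℤ) ≤
        (#(comparable w v \ U) : ℤ) := by
    intro v hv
    have h1 := hov v hv
    have h2 := card_inter_add_card_sdiff (comparable w v) U
    rw [hB, mem_filter] at hv
    rw [card_comparable_of_ge (by omega), hv.2] at h2
    rw [← h2]
    have h3 : (#(comparable w v ∩ U) : ℤ) ≤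
      (((w + t - s + 1) / (t + 1) : ℕ) : ℤ) * ((t + 1).choose (t - s + 1) : ℤ) := by
      exact_mod_cast h1
    push_cast at h3 ⊢
    linarith
  have hsum := sum_le_sum hlow
  rw [sum_const, nsmul_eq_mul, mul_comm] at hsum
  have hdU : Disjoint U (B.biUnion fun v => comparable w v \ U) := by
    rw [disjoint_biUnion_right]
    exact fun v _ => disjoint_sdiff
  have htot : #U + #(B.biUnion fun v => comparable w v \ U) ≤ (Fintype.card α).choose w := by
    rw [← card_union_of_disjoint hdU, ← card_univ, ← card_powersetCard]
    refine card_le_card (union_subset (biUnion_subset.2 fun x _ => filter_subset _ _)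
      (biUnion_subset.2 fun x _ => sdiff_subset.trans (filter_subset _ _)))
  rw [packing_weightCount F hst hsw hw, ← card_biUnion (hF.pairwiseDisjoint_window hst)]
  rw [card_biUnion hBd] at htot
  have hz : weightCount F (w + t - s + 1) = #B := rfl
  rw [hz]
  have : (#U : ℤ) + ∑ v ∈ B, (#(comparable w v \ U) : ℤ) ≤ ((Fintype.card α).choose w : ℤ) := by
    exact_mod_cast htot
  linarith

/-- The family of complements. -/
def complFamily (F : Finset (Finset α)) : Finset (Finset α) := F.map ⟨compl, compl_injective⟩

theorem mem_complFamily {F : Finset (Finset α)} {x : Finset α} :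
    x ∈ complFamily F ↔ xᶜ ∈ F := by
  simp only [complFamily, mem_map, Function.Embedding.coeFn_mk]
  constructor
  · rintro ⟨y, hy, rfl⟩
    rwa [compl_compl]
  · exact fun h => ⟨_, h, compl_compl x⟩

theorem AsymSep.compl {t : ℕ} {F : Finset (Finset α)} (hF : AsymSep t F) :
    AsymSep t (complFamily F) := by
  intro x hx y hy hxy
  rw [mem_complFamily] at hx hy
  have := hF _ hx _ hy (fun h => hxy (compl_injective h))
  rwa [compl_sdiff_compl, compl_sdiff_compl, or_comm] at this

theorem weightCount_complFamily (F : Finset (Finset α)) {k : ℕ} (hk : k ≤ Fintype.card α) :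
    weightCount (complFamily F) k = weightCount F (Fintype.card α - k) := by
  unfold weightCount complFamily
  rw [filter_map, card_map]
  congr 1
  refine filter_congr fun x _ => ?_
  simp only [Function.comp_apply, Function.Embedding.coeFn_mk, card_compl]
  have := card_le_univ x
  omega

/-- Complementation interchanges the two sums of `packing`. The weight-w term, which always belongs
to the second sum, is split off on both sides. -/
theorem packing_complFamily (F : Finset (Finset α)) {t w s : ℕ} (hst : s ≤ t) (hsw : s ≤ w)
    (hw : w + t ≤ Fintype.card α) :
    packing (Fintype.card α) t (weightCount (complFamily F)) (Fintype.card α - w) (t - s) =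
      packing (Fintype.card α) t (weightCount F) w s := by
  unfold packing
  rw [show Fintype.card α - (Fintype.card α - w) = w by omega, show t - (t - s) = s by omega,
    range_eq_Ico, range_eq_Ico, sum_eq_sum_Ico_succ_bot (by omega),
    sum_eq_sum_Ico_succ_bot (b := t - s + 1) (by omega)]
  have e1 : ∑ i ∈ Icc 1 (t - s), (w + i).choose i *
      weightCount (complFamily F) (Fintype.card α - w - i) =
      ∑ i ∈ Ico (0 + 1) (t - s + 1), (w + i).choose i * weightCount F (w + i) := by
    refine sum_congr (by ext; simp only [mem_Icc, mem_Ico]; omega) fun i hi => ?_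
    rw [mem_Ico] at hi
    rw [weightCount_complFamily F (by omega)]
    congr 2
    omega
  have e2 : ∑ i ∈ Ico (0 + 1) (s + 1), (Fintype.card α - w + i).choose i *
      weightCount (complFamily F) (Fintype.card α - w + i) =
      ∑ i ∈ Icc 1 s, (Fintype.card α - w + i).choose i * weightCount F (w - i) := by
    refine sum_congr (by ext; simp only [mem_Icc, mem_Ico]; omega) fun i hi => ?_
    rw [mem_Icc] at hi
    rw [weightCount_complFamily F (by omega)]
    congr 2
    omega
  rw [e1, e2, weightCount_complFamily F (by omega),
    show Fintype.card α - (Fintype.card α - w + 0) = w by omega]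
  simp only [Nat.choose_zero_right, Nat.add_zero]
  omega

/-- The dual of `AsymSep.packing_up_le` under complementation; s < t becomes t - s ≥ 1. -/
theorem AsymSep.packing_down_le {t w s : ℕ} {F : Finset (Finset α)} (hF : AsymSep t F)
    (hst : s < t) (htw : t < w) (hw : w + t < Fintype.card α) :
    (packing (Fintype.card α) t (weightCount F) w s : ℤ) +
      (((Fintype.card α - w + s + 1).choose (s + 1) : ℤ) -
        ((t + 1).choose (t - s) : ℤ) * (((Fintype.card α - w + s + 1) / (t + 1) : ℕ) : ℤ)) *
        (weightCount F (w - s - 1) : ℤ) ≤ ((Fintype.card α).choose w : ℤ) := by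
  have h := hF.compl.packing_up_le (w := Fintype.card α - w) (s := t - s) (by omega) (by omega)
    (by omega) (by omega)
  rw [packing_complFamily F hst.le (by omega) (by omega), Nat.choose_symm (by omega),
    show Fintype.card α - w + t - (t - s) + 1 = Fintype.card α - w + s + 1 by omega,
    show t - (t - s) + 1 = t + 1 - (t - s) by omega, Nat.choose_symm (by omega),
    weightCount_complFamily F (by omega),
    show Fintype.card α - (Fintype.card α - w + s + 1) = w - s - 1 by omega,
    ← Nat.choose_symm (show Fintype.card α - w ≤ Fintype.card α - w + s + 1 by omega),
    show Fintype.card α - w + s + 1 - (Fintype.card α - w) = s + 1 by omega] at h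
  exact h

end Families

/-! ### Constant-weight codes -/

section ConstantWeight

variable {β : Type*} [DecidableEq β]

/-- `G` is a constant-weight code of distance at least `d` and weight `w`, written as a family of
supports. -/
def IsConstWeight (d w : ℕ) (G : Finset (Finset β)) : Prop :=
  (∀ x ∈ G, #x = w) ∧ ∀ x ∈ G, ∀ y ∈ G, x ≠ y → d ≤ #(x \ y) + #(y \ x)

/-- The support of a word, as an equivalence. -/
def support (n : ℕ) : Word n ≃ Finset (Fin n) where
  toFun x := {i | x i = true}
  invFun s i := decide (i ∈ s)
  left_inv x := by
    ext i
    simp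
  right_inv s := by
    ext i
    simp

theorem mem_support {n : ℕ} {x : Word n} {i : Fin n} : i ∈ support n x ↔ x i = true := by
  simp [support]

theorem card_support {n : ℕ} (x : Word n) : #(support n x) = weight x := rfl

theorem hammingDist_eq_card_sdiff {n : ℕ} (x y : Word n) :
    hammingDist x y =
      #(support n x \ support n y) + #(support n y \ support n x) := by
  rw [← card_union_of_disjoint disjoint_sdiff_sdiff, hammingDist]
  congr 1
  ext i
  simp only [mem_filter, mem_univ, true_and, mem_union, mem_sdiff, mem_support]
  cases x i <;> cases y i <;> simp

theorem card_le_constWeightMax_of_fin {m d w : ℕ} {G : Finset (Finset (Fin m))}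
    (hG : IsConstWeight d w G) : #G ≤ constWeightMax m d w := by
  classical
  rw [← card_map (support m).symm.toEmbedding]
  refine le_sup (f := card) (mem_filter.2 ⟨mem_univ _, ?_, ?_⟩)
  · intro x hx
    rw [mem_map_equiv, Equiv.symm_symm] at hx
    rw [← card_support]
    exact hG.1 _ hx
  · intro x hx y hy hxy
    rw [mem_map_equiv, Equiv.symm_symm] at hx hy
    rw [hammingDist_eq_card_sdiff]
    exact hG.2 _ hx _ hy ((support m).injective.ne hxy)

theorem exists_card_eq_constWeightMax (m d w : ℕ) :
    ∃ G : Finset (Finset (Fin m)), IsConstWeight d w G ∧ #G = constWeightMax m d w := by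
  classical
  obtain ⟨C, hC, hmax⟩ := exists_mem_eq_sup
    (univ.filter fun C : Finset (Word m) =>
      (∀ x ∈ C, weight x = w) ∧ ∀ x ∈ C, ∀ y ∈ C, x ≠ y → d ≤ hammingDist x y)
    ⟨∅, by simp⟩ card
  obtain ⟨-, h1, h2⟩ := mem_filter.1 hC
  refine ⟨C.map (support m).toEmbedding, ⟨?_, ?_⟩, ?_⟩
  · intro x hx
    rw [mem_map_equiv] at hx
    rw [← h1 _ hx, ← card_support, Equiv.apply_symm_apply]
  · intro x hx y hy hxy
    rw [mem_map_equiv] at hx hy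
    have := h2 _ hx _ hy ((support m).symm.injective.ne hxy)
    rwa [hammingDist_eq_card_sdiff, Equiv.apply_symm_apply, Equiv.apply_symm_apply] at this
  · rw [card_map, constWeightMax, ← hmax]

theorem card_le_constWeightMax [Fintype β] {d w : ℕ} {G : Finset (Finset β)}
    (hG : IsConstWeight d w G) : #G ≤ constWeightMax (Fintype.card β) d w := by
  set e := (Fintype.equivFin β).finsetCongr with he
  have hcard : ∀ x, #(e.symm x) = #x := fun x => by simp [he, Equiv.finsetCongr_symm]
  have hsd : ∀ x y, #(e.symm x \ e.symm y) = #(x \ y) := fun x y => by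
    simp only [he, Equiv.finsetCongr_symm, Equiv.finsetCongr_apply]
    rw [← Finset.map_sdiff, card_map]
  rw [← card_map e.toEmbedding]
  refine card_le_constWeightMax_of_fin ⟨?_, ?_⟩
  · intro x hx
    rw [mem_map_equiv] at hx
    rw [← hG.1 _ hx, hcard]
  · intro x hx y hy hxy
    rw [mem_map_equiv] at hx hy
    have := hG.2 _ hx _ hy (e.symm.injective.ne hxy)
    rwa [hsd, hsd] at this

theorem card_disjSum_sdiff {γ : Type*} [DecidableEq γ] (a a' : Finset β) (b b' : Finset γ) :
    #(a.disjSum b \ a'.disjSum b') = #(a \ a') + #(b \ b') := by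
  rw [← card_disjSum]
  congr 1
  ext (x | x) <;> simp

/-- Codewords of weight `j ∈ [s, r]`, followed by the words of a constant-weight code of length
`r - s` and weight `r - j`, form a constant-weight code of weight `r`. -/
theorem AsymSep.sum_le_constWeightMax {α : Type*} [DecidableEq α] [Fintype α] {t s r : ℕ}
    {F : Finset (Finset α)} (hF : AsymSep t F) (hsr : s ≤ r) :
    ∑ j ∈ Icc s r, constWeightMax (r - s) (2 * t + 2) (r - j) * weightCount F j ≤
      constWeightMax (Fintype.card α + r - s) (2 * t + 2) r := by
  choose T hT hTc using exists_card_eq_constWeightMax (r - s) (2 * t + 2)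
  have hsum := sum_mul_weightCount F (Icc s r)
    (fun j => constWeightMax (r - s) (2 * t + 2) (r - j))
  simp only [Nat.cast_id] at hsum
  rw [hsum]
  set S := ({x ∈ F | #x ∈ Icc s r} : Finset _).sigma fun x => T (r - #x) with hS
  have hinj : Function.Injective
      fun p : (_ : Finset α) × Finset (Fin (r - s)) => p.1.disjSum p.2 := by
    rintro ⟨a, b⟩ ⟨a', b'⟩ h
    obtain ⟨h1, h2⟩ := disjSum_inj.1 h
    subst h1 h2
    rfl
  have hcard : #(S.map ⟨_, hinj⟩) =
      ∑ x ∈ F with #x ∈ Icc s r, constWeightMax (r - s) (2 * t + 2) (r - #x) := by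
    rw [card_map, hS, card_sigma]
    exact sum_congr rfl fun x _ => hTc _
  rw [← hcard, show Fintype.card α + r - s = Fintype.card (α ⊕ Fin (r - s)) by
    rw [Fintype.card_sum, Fintype.card_fin]; omega]
  refine card_le_constWeightMax ⟨?_, ?_⟩
  · intro x hx
    obtain ⟨⟨a, b⟩, hp, rfl⟩ := mem_map.1 hx
    rw [hS, mem_sigma, mem_filter, mem_Icc] at hp
    obtain ⟨⟨-, -, h1⟩, h2⟩ := hp
    have := (hT _).1 _ h2
    simp only [Function.Embedding.coeFn_mk, card_disjSum] at h1 this ⊢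
    omega
  · intro x hx y hy hxy
    obtain ⟨⟨a, b⟩, hp, rfl⟩ := mem_map.1 hx
    obtain ⟨⟨a', b'⟩, hq, rfl⟩ := mem_map.1 hy
    rw [hS, mem_sigma, mem_filter, mem_Icc] at hp hq
    obtain ⟨⟨ha, -, har⟩, hb⟩ := hp
    obtain ⟨⟨ha', -, har'⟩, hb'⟩ := hq
    simp only [Function.Embedding.coeFn_mk, card_disjSum_sdiff] at ha ha' har har' hb hb' hxy ⊢
    by_cases h : a = a'
    · subst h
      have hne : b ≠ b' := fun h => hxy (by rw [h])
      have := (hT _).2 _ hb _ hb' hne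
      omega
    -- Both extended words have weight r, so their two differences have equal size; one exceeds t,
    -- hence the distance is at least 2t + 2.
    · have h1 := hF a ha a' ha' h
      have h2 := (hT _).1 _ hb
      have h3 := (hT _).1 _ hb'
      have h4 := card_sdiff_add_card_inter a a'
      have h5 := card_sdiff_add_card_inter a' a
      have h6 := card_sdiff_add_card_inter b b'
      have h7 := card_sdiff_add_card_inter b' b
      rw [inter_comm a' a] at h5
      rw [inter_comm b' b] at h7
      omega

end ConstantWeight

/-! ### Clouds, free points and codes containing 0 -/

section Codes

variable {n t : ℕ}

theorem reaches_iff {x y : Word n} :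
    Reaches t x y ↔
      support n y ⊆ support n x ∧ #(support n x \ support n y) ≤ t := by
  have h : (∀ i, x i ≠ y i → x i = true ∧ y i = false) ↔ support n y ⊆ support n x := by
    simp only [subset_iff, mem_support]
    refine forall_congr' fun i => ?_
    cases x i <;> cases y i <;> simp
  rw [Reaches, h]
  refine and_congr_right fun hs => ?_
  rw [hammingDist_eq_card_sdiff, sdiff_eq_empty_iff_subset.2 hs, card_empty, Nat.add_zero]

theorem mem_cloud {x y : Word n} : y ∈ cloud t x ↔ Reaches t x y := by
  simp [cloud]

theorem card_cloud (x : Word n) :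
    #(cloud t x) = ∑ j ∈ range (t + 1), (#(support n x)).choose j := by
  rw [← card_powerset_sdiff_le, ← card_map (support n).toEmbedding]
  congr 1
  ext u
  rw [mem_map_equiv, mem_cloud, reaches_iff, Equiv.apply_symm_apply, mem_filter, mem_powerset]

/-- The supports of the codewords. -/
def supports (C : Finset (Word n)) : Finset (Finset (Fin n)) := C.map (support n).toEmbedding

/-- If both differences had at most t elements, the intersection of the supports would lie in both
clouds. -/
theorem Corrects.asymSep {C : Finset (Word n)} (hC : Corrects t C) : AsymSep t (supports C) := by
  intro x hx y hy hxy
  rw [supports, mem_map_equiv] at hx hy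
  by_contra! h
  have hd := hC _ hx _ hy ((support n).symm.injective.ne hxy)
  refine Finset.disjoint_left.1 hd (?_ : (support n).symm (x ∩ y) ∈ _) ?_
  · rw [mem_cloud, reaches_iff]
    simp only [Equiv.apply_symm_apply, sdiff_inter_self_left]
    exact ⟨inter_subset_left, h.1⟩
  · rw [mem_cloud, reaches_iff]
    simp only [Equiv.apply_symm_apply, sdiff_inter_self_right]
    exact ⟨inter_subset_right, h.2⟩

theorem Corrects.subset {C D : Finset (Word n)} (hC : Corrects t C) (h : D ⊆ C) :
    Corrects t D := fun x hx y hy => hC x (h hx) y (h hy)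

theorem exists_corrects_card_eq {M : ℕ} (hM : M ≤ maxCard n t) :
    ∃ C : Finset (Word n), Corrects t C ∧ #C = M := by
  classical
  obtain ⟨C, hC, hmax⟩ := exists_mem_eq_sup
    (univ.filter fun C : Finset (Word n) => Corrects t C) ⟨∅, mem_filter.2 ⟨mem_univ _, fun x hx => absurd hx (notMem_empty x)⟩⟩ card
  rw [maxCard, hmax] at hM
  obtain ⟨D, hD, hDM⟩ := exists_subset_card_eq hM
  exact ⟨D, (mem_filter.1 hC).2.subset hD, hDM⟩

theorem support_zero : support n (fun _ => false) = ∅ := by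
  ext i
  simp [mem_support]

theorem zero_mem_cloud_iff {x : Word n} :
    (fun _ => false) ∈ cloud t x ↔ #(support n x) ≤ t := by
  rw [mem_cloud, reaches_iff, support_zero, sdiff_empty]
  simp

theorem cloud_zero : cloud t (fun _ => false : Word n) = {fun _ => false} := by
  ext y
  rw [mem_cloud, reaches_iff, support_zero, mem_singleton, subset_empty, ← support_zero,
    (support n).apply_eq_iff_eq]
  simp [support_zero]

theorem Corrects.card_freePoints_add {C : Finset (Word n)} (hC : Corrects t C) :
    #(freePoints t C) + ∑ x ∈ C, #(cloud t x) = 2 ^ n := by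
  classical
  have h1 : freePoints t C = (C.biUnion (cloud t))ᶜ := by
    ext p
    simp [freePoints]
  rw [← card_biUnion (fun x hx y hy hxy => hC x hx y hy hxy), h1, card_compl_add_card]
  simp

/-- A nonempty code may be modified to contain the word `0`, with no loss of free points. -/
theorem Corrects.exists_zero_mem {C : Finset (Word n)} (hC : Corrects t C) (hne : C.Nonempty) :
    ∃ D : Finset (Word n), Corrects t D ∧ #D = #C ∧ (fun _ => false) ∈ D ∧
      #(freePoints t C) ≤ #(freePoints t D) := by
  -- The codeword to replace by 0: the one whose cloud contains 0, if any, and otherwise an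
  -- arbitrary one.
  obtain ⟨x, hx, hx0⟩ : ∃ x ∈ C, ∀ y ∈ C, y ≠ x → (fun _ => false) ∉ cloud t y := by
    by_cases h : ∃ x ∈ C, (fun _ => false) ∈ cloud t x
    · obtain ⟨x, hx, h0⟩ := h
      exact ⟨x, hx, fun y hy hyx hy0 => Finset.disjoint_left.1 (hC y hy x hx hyx) hy0 h0⟩
    · push Not at h
      obtain ⟨x, hx⟩ := hne
      exact ⟨x, hx, fun y hy _ => h y hy⟩
  have h0 : (fun _ => false) ∉ C.erase x := by
    intro h
    rw [mem_erase] at h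
    exact hx0 _ h.2 h.1 (by rw [cloud_zero]; exact mem_singleton_self _)
  have hD : Corrects t (insert (fun _ => false) (C.erase x)) := by
    intro y hy z hz hyz
    rw [mem_insert, mem_erase] at hy hz
    rcases hy with rfl | hy <;> rcases hz with rfl | hz
    · exact absurd rfl hyz
    · rw [cloud_zero, disjoint_singleton_left]
      exact hx0 z hz.2 hz.1
    · rw [cloud_zero, disjoint_singleton_right]
      exact hx0 y hy.2 hy.1
    · exact hC y hy.2 z hz.2 hyz
  have hcard : #(insert (fun _ => false) (C.erase x)) = #C := by
    rw [card_insert_of_notMem h0, card_erase_add_one hx]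
  refine ⟨_, hD, hcard, mem_insert_self _ _, ?_⟩
  -- The new cloud is the single point 0, no larger than the cloud it replaces.
  have hle : 1 ≤ #(cloud t x) := by
    rw [card_cloud, sum_range_succ']
    simp
  have h1 := hC.card_freePoints_add
  have h2 := hD.card_freePoints_add
  rw [sum_insert h0, cloud_zero, card_singleton] at h2
  have h3 : #(cloud t x) + ∑ y ∈ C.erase x, #(cloud t y) = ∑ y ∈ C, #(cloud t y) :=
    add_sum_erase C (fun y => #(cloud t y)) hx
  refine Nat.le_of_add_le_add_right (b := 1 + ∑ y ∈ C.erase x, #(cloud t y)) ?_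
  refine le_trans ?_ h2.ge
  omega

theorem Corrects.card_freePoints {C : Finset (Word n)} (hC : Corrects t C) :
    (#(freePoints t C) : ℤ) = objective n t (weightCount (supports C)) := by
  have h2 := sum_mul_weightCount (supports C) (range (n + 1))
    (fun i => ∑ j ∈ range (t + 1), (i.choose j : ℤ))
  have h3 : ({x ∈ supports C | #x ∈ range (n + 1)} : Finset _) = supports C := by
    refine filter_true_of_mem fun x _ => ?_
    have := card_le_univ x
    rw [Fintype.card_fin] at this
    exact mem_range.2 (by omega)
  rw [h3, supports, sum_map] at h2
  rw [objective, sum_congr rfl fun i _ => mul_comm _ _, supports, h2, eq_sub_iff_add_eq]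
  have h4 := hC.card_freePoints_add
  simp only [card_cloud] at h4
  exact_mod_cast h4

end Codes

theorem Corrects.feasible {n t : ℕ} {C : Finset (Word n)} (hC : Corrects t C)
    (h0 : (fun _ => false) ∈ C) {L U : ℕ → ℕ → ℕ → ℝ}
    (hL : ∀ m d w, L m d w ≤ (constWeightMax m d w : ℝ))
    (hU : ∀ m d w, (constWeightMax m d w : ℝ) ≤ U m d w) :
    Feasible L U n #C t (weightCount (supports C)) := by
  classical
  have hF := hC.asymSep
  have hn : Fintype.card (Fin n) = n := Fintype.card_fin n
  have hsmall : ∀ x ∈ supports C, #x ≤ t → x = ∅ := by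
    intro x hx hxt
    rw [supports, mem_map_equiv] at hx
    by_contra hne
    have hne' : (support n).symm x ≠ fun _ => false := by
      intro h
      apply hne
      rw [Equiv.symm_apply_eq] at h
      rw [h, support_zero]
    refine Finset.disjoint_left.1 (hC _ hx _ h0 hne') (?_ : (fun _ => false) ∈ _) ?_
    · rwa [zero_mem_cloud_iff, Equiv.apply_symm_apply]
    · rw [cloud_zero]
      exact mem_singleton_self _
  have hlow : ∀ F : Finset (Finset (Fin n)), AsymSep t F → ∀ s r, s ≤ r →
      ∑ j ∈ Icc s r, (weightCount F j : ℝ) * L (r - s) (2 * t + 2) (r - j) ≤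
        U (n + r - s) (2 * t + 2) r := by
    intro F hF s r hsr
    have h := hF.sum_le_constWeightMax hsr
    rw [hn] at h
    refine le_trans ?_ (hU _ _ _)
    refine le_trans ?_ (Nat.cast_le.2 h)
    push_cast
    refine sum_le_sum fun j _ => ?_
    rw [mul_comm]
    exact mul_le_mul_of_nonneg_right (hL _ _ _) (Nat.cast_nonneg _)
  refine ⟨?_, ?_, ?_, ?_, hlow _ hF, ?_, ?_, ?_, ?_⟩
  · intro i hi
    exact weightCount_eq_zero _ (by rwa [hn])
  · rw [weightCount, card_eq_one]
    refine ⟨∅, ?_⟩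
    ext x
    rw [mem_filter, mem_singleton, card_eq_zero, and_iff_right_iff_imp]
    rintro rfl
    rw [supports, mem_map_equiv]
    rwa [← support_zero, Equiv.symm_apply_apply]
  · intro i hi hit
    refine card_eq_zero.2 (filter_eq_empty_iff.2 fun x hx hxi => ?_)
    have := hsmall x hx (by omega)
    rw [this, card_empty] at hxi
    omega
  · intro s w hst htw hwn
    have := hF.packing_le (w := w) hst (by omega) (by omega)
    rwa [hn] at this
  -- Complementing turns the constraint at high weights into the one at low weights; terms with j >
  -- n vanish.
  · intro s r hsr
    have h := hlow _ hF.compl s r hsr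
    refine le_trans (le_of_eq ?_) h
    rw [sum_filter]
    refine sum_congr rfl fun j _ => ?_
    split_ifs with hj
    · rw [weightCount_complFamily _ (by omega), hn]
    · rw [weightCount_eq_zero _ (by omega), Nat.cast_zero, zero_mul]
  · intro s w hs hst htw hwn
    have := hF.packing_up_le (w := w) hs hst (by omega) (by omega)
    rwa [hn] at this
  · intro s w hst htw hwn
    have := hF.packing_down_le (w := w) hst htw (by omega)
    rwa [hn] at this
  · have h := sum_mul_weightCount (supports C) (range (n + 1)) (fun _ => 1)
    simp only [Nat.cast_id, one_mul, sum_const, smul_eq_mul, mul_one] at h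
    rw [h, filter_true_of_mem, supports, card_map]
    intro x _
    have := card_le_univ x
    rw [hn] at this
    exact mem_range.2 (by omega)

end AsymCode

theorem mainTheorem6 (n t M : ℕ) (ht : 2 ≤ 2 * t) (hn : 2 * t ≤ n)
    (hM : 1 ≤ M) (hMZ : M ≤ AsymCode.maxCard n t)
    (L U : ℕ → ℕ → ℕ → ℝ)
    (hL : ∀ m d w, L m d w ≤ (AsymCode.constWeightMax m d w : ℝ))
    (hU : ∀ m d w, (AsymCode.constWeightMax m d w : ℝ) ≤ U m d w) :
    IsGreatest (AsymCode.values L U n M t) (AsymCode.Fbar L U n M t) ∧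
      ∀ C : Finset (AsymCode.Word n), AsymCode.Corrects t C → C.card = M →
        ((AsymCode.freePoints t C).card : ℤ) ≤ AsymCode.Fbar L U n M t := by
  have key : ∀ C : Finset (AsymCode.Word n), AsymCode.Corrects t C → C.card = M →
      ∃ v ∈ AsymCode.values L U n M t, ((AsymCode.freePoints t C).card : ℤ) ≤ v := by
    intro C hC hCM
    obtain ⟨D, hD, hDC, h0, hle⟩ := hC.exists_zero_mem (Finset.card_pos.1 (by omega))
    refine ⟨_, ⟨_, hCM ▸ hDC ▸ hD.feasible h0 hL hU, rfl⟩, ?_⟩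
    rw [← hD.card_freePoints]
    exact_mod_cast hle
  -- An integer `sSup` is an attained maximum once the set is nonempty and bounded above; a code of
  -- size M supplies a feasible point.
  have hbdd : BddAbove (AsymCode.values L U n M t) := by
    refine ⟨2 ^ n, ?_⟩
    rintro v ⟨z, -, rfl⟩
    exact sub_le_self _ (by positivity)
  obtain ⟨C, hC, hCM⟩ := AsymCode.exists_corrects_card_eq hMZ
  obtain ⟨v, hv, -⟩ := key C hC hCM
  refine ⟨⟨Int.csSup_mem ⟨v, hv⟩ hbdd, fun u hu => le_csSup hbdd hu⟩, ?_⟩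
  intro C hC hCM
  obtain ⟨v, hv, hle⟩ := key C hC hCM
  exact hle.trans (le_csSup hbdd hv)
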